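/- **The process.** For $n\ge 1$ the semi-random graph process on $[n]=\{1,\dots,n\}$ starts from the empty graph $H_0$ on $[n]$. In each step $i\ge 1$ a vertex $u_i\in[n]$ is chosen uniformly at random, independently of the past; the player then chooses a vertex $v_i\in[n]$, and the edge $u_iv_i$ is added to $H_{i-1}$ to form the multigraph $H_i$ (loops and parallel edges are allowed). A strategy $\mathcal S$ specifies, for every $n\ge1$, every $i\ge1$ and every possible history $(u_1,v_1,\dots,u_{i-1},v_{i-1},u_i)$, a probability distribution on $[n]$ from which $v_i$ is drawn. **Degeneracy.** Let $G$ be a finite graph, possibly with loops and parallel edges. The degree of a vertex is the number of edges incident with it, so a parallel edge is counted with multiplicity and a loop contributes one. $G$ is $d$-degenerate if every non-empty subgraph of $G$ has a vertex of degree at most $d$ in that subgraph; the degeneracy of $G$ is the least $d$ for which $G$ is $d$-degenerate. **Theorem.** Let $G$ be a fixed finite graph, possibly with loops and parallel edges, of degeneracy $d\ge 2$. Let $\omega=\omega(n)$ be any real function with $\omega(n)\to\infty$ as $n\to\infty$, and let $t=t(n)$ be non-negative integers with $t(n)\le n^{(d-1)/d}/\omega(n)$ for all sufficiently large $n$. Then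 for every strategy $\mathcal S$, $$\lim_{n\to\infty}\mathbb P\big[\,H_{t(n)}\text{ contains a copy of }G\,\big]=0,$$ where $H_t$ contains a copy of $G$ if $G$ is isomorphic to a (not necessarily induced) subgraph of $H_t$, respecting edge multiplicities and loops. -/

import Mathlib

open Filter Topology

namespace SemiRandom

/-- The degree of a vertex in a multigraph: the number of edges incident with it.
Parallel edges are counted with multiplicity and a loop contributes one. -/
noncomputable def degree {α β : Type*} (G : Graph α β) (v : α) : ℕ :=
  (G.incidenceSet v).ncard

/-- A (finite) multigraph is `d`-degenerate if every subgraph having at least one vertex has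
minimum degree at most `d`. -/
def IsDegenerate {α β : Type*} (G : Graph α β) (d : ℕ) : Prop :=
  ∀ G' : Graph α β, G' ≤ G → G'.vertexSet.Nonempty → ∃ v ∈ G'.vertexSet, degree G' v ≤ d

/-- The degeneracy of a finite multigraph: the smallest `d` for which it is `d`-degenerate. -/
noncomputable def degeneracy {α β : Type*} (G : Graph α β) : ℕ :=
  sInf {d : ℕ | IsDegenerate G d}

/-- `H` contains a copy of `G`: there are injections of the vertices and of the edges of `G` into
those of `H` that respect the ends of edges, i.e. `G` is isomorphic to a subgraph of `H`. -/
def ContainsCopy {α β γ δ : Type*} (G : Graph α β) (H : Graph γ δ) : Prop :=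
  ∃ (φ : G.vertexSet ↪ H.vertexSet) (ψ : G.edgeSet ↪ H.edgeSet),
    ∀ (e : G.edgeSet) (x y : G.vertexSet), G.IsLink e x y → H.IsLink (ψ e) (φ x) (φ y)

/-- The record `(u_1, v_1), …, (u_t, v_t)` of the first `t` rounds on the vertex set `Fin n`:
in each round the random vertex ("square") and the vertex chosen by the player ("circle"). -/
abbrev History (n t : ℕ) : Type := Fin t → Fin n × Fin n

/-- A (possibly randomised, adaptive) strategy on `n` vertices. `S t h u` is the distribution of the
player's answer in round `t + 1`, when `h` is the record of the first `t` rounds and `u` is the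
vertex that has just been presented. -/
abbrev Strategy (n : ℕ) : Type := (t : ℕ) → History n t → Fin n → PMF (Fin n)

/-- The law of the record of the first `t` rounds when the player follows the strategy `S`: in each
round the presented vertex `u` is uniform and independent of the past, and then the player's vertex
`v` is drawn from the distribution prescribed by `S`. -/
noncomputable def historyLaw {n : ℕ} [NeZero n] (S : Strategy n) : (t : ℕ) → PMF (History n t)
  | 0 => PMF.pure Fin.elim0
  | t + 1 =>
    (historyLaw S t).bind fun h =>
      (PMF.uniformOfFintype (Fin n)).bind fun u =>
        (S t h u).map fun v => Fin.snoc (α := fun _ => Fin n × Fin n) h (u, v)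

/-- The multigraph built in the recorded rounds: its vertex set is all of `Fin n`, and round `i`
contributes one edge, labelled `i`, with ends `u_i` and `v_i`. Loops and parallel edges may occur. -/
def builtGraph {n t : ℕ} (h : History n t) : Graph (Fin n) (Fin t) where
  vertexSet := Set.univ
  edgeSet := Set.univ
  IsLink i x y := s((h i).1, (h i).2) = s(x, y)
  isLink_symm := fun _ _ => ⟨fun _ _ hxy => hxy.trans Sym2.eq_swap⟩
  eq_or_eq_of_isLink_of_isLink := by
    intro e x y v w h₁ h₂
    rw [h₁, Sym2.eq_iff] at h₂
    tauto
  edge_mem_iff_exists_isLink := fun e => ⟨fun _ => ⟨(h e).1, (h e).2, rfl⟩, fun _ => Set.mem_univ e⟩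
  left_mem_of_isLink := fun _ _ _ _ => Set.mem_univ _

/-- The probability that, after `t` rounds played according to `S`, the multigraph that has been
built contains a copy of `G`. -/
noncomputable def copyProb {α β : Type*} (G : Graph α β) {n : ℕ} [NeZero n] (S : Strategy n)
    (t : ℕ) : ENNReal :=
  (historyLaw S t).toOuterMeasure {h : History n t | ContainsCopy G (builtGraph h)}

end SemiRandom

/-!
Only a subgraph of minimum degree at least `d` of the fixed graph matters. Direct every edge from
the random vertex (the square) to the player's vertex (the circle).

*Combinatorics.* If a multigraph of minimum degree at least `d` is built edge by edge, then for some
vertex `v` at least `d` of the edges have a square that, when the edge arrives, is already reachable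
from `v` along directed paths of earlier edges (`exists_degree_le_reach`). Call such a round a hit
of `v`. Directed paths inside a copy of the fixed graph have bounded length `k`, so `v` has `d` hits
even if only paths of length at most `k` are followed (`exists_le_hits`).

*Probability.* Another square at `v` is always a hit of `v`; so as long as no vertex has `d` hits,
no vertex carries `d` squares, and at most `B = d ^ k` vertices can be reached from `v` by at most
`k` steps. Hence each round is a hit of `v` with probability at most `B / n`, whatever the player
does: the hit is decided by the square alone. Truncating the reachable sets at size `B` makes this
bound unconditional, and `∑ v, z ^ hits v` then has mean at most `n * (1 + B * z / n) ^ t`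
(`tsum_historyLaw_mul_le`). By Markov's inequality some vertex has `d` hits with probability at most
`n * z ^ (-d) * exp (B * z * t / n)`, which for `z = n ^ (1 / d) * ω` is at most
`exp B / ω ^ d` (`copyProb_le`).
-/

namespace SemiRandom

open scoped ENNReal

/-! ### Out-balls of a relation -/

open Classical in
/-- The vertices reachable from `v` by at most `j` steps of the relation `r`. -/
noncomputable def outBall {α : Type*} [Fintype α] (r : α → α → Prop) (v : α) : ℕ → Finset α
  | 0 => {v}
  | j + 1 => Finset.univ.filter fun b => b ∈ outBall r v j ∨ ∃ a ∈ outBall r v j, r a b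

lemma mem_outBall_succ {α : Type*} [Fintype α] {r : α → α → Prop} {v b : α} {j : ℕ} :
    b ∈ outBall r v (j + 1) ↔ b ∈ outBall r v j ∨ ∃ a ∈ outBall r v j, r a b := by
  simp [outBall]

lemma outBall_mono {α : Type*} [Fintype α] (r : α → α → Prop) (v : α) :
    Monotone (outBall r v) :=
  monotone_nat_of_le_succ fun _ _ hb => mem_outBall_succ.2 (Or.inl hb)

lemma self_mem_outBall {α : Type*} [Fintype α] (r : α → α → Prop) (v : α) (j : ℕ) :
    v ∈ outBall r v j :=
  outBall_mono r v (Nat.zero_le j) (by simp [outBall])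

lemma outBall_subset_of_imp {α : Type*} [Fintype α] {r r' : α → α → Prop}
    (hr : ∀ a b, r a b → r' a b) (v : α) (j : ℕ) : outBall r v j ⊆ outBall r' v j := by
  induction j with
  | zero => simp [outBall]
  | succ j ih =>
    intro b hb
    rw [mem_outBall_succ] at hb ⊢
    exact hb.imp (fun h => ih h) fun ⟨a, ha, hab⟩ => ⟨a, ih ha, hr _ _ hab⟩

open Classical in
lemma card_outBall_le {α : Type*} [Fintype α] {r : α → α → Prop} {m : ℕ}
    (hr : ∀ a, (Finset.univ.filter (r a)).card ≤ m) (v : α) (j : ℕ) :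
    (outBall r v j).card ≤ (m + 1) ^ j := by
  induction j with
  | zero => simp [outBall]
  | succ j ih =>
    have hsub : outBall r v (j + 1) ⊆
        outBall r v j ∪ (outBall r v j).biUnion fun a => Finset.univ.filter (r a) := by
      intro b hb
      rw [mem_outBall_succ] at hb
      simpa using hb
    calc (outBall r v (j + 1)).card
        ≤ (outBall r v j).card +
            ((outBall r v j).biUnion fun a => Finset.univ.filter (r a)).card :=
          (Finset.card_le_card hsub).trans (Finset.card_union_le _ _)
      _ ≤ (outBall r v j).card + (outBall r v j).card * m := by
          gcongr
          exact Finset.card_biUnion_le_card_mul _ _ _ fun a _ => hr a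
      _ = (outBall r v j).card * (m + 1) := by ring
      _ ≤ (m + 1) ^ (j + 1) := by rw [pow_succ]; gcongr

/-- An out-ball either has exhausted everything reachable or has grown in every step; hence, inside
a closed set `W`, everything reachable is reached within `W.card` steps. -/
lemma mem_outBall_of_reflTransGen {α : Type*} [Fintype α] {r : α → α → Prop} {W : Finset α}
    (hW : ∀ a b, r a b → b ∈ W) {v : α} (hv : v ∈ W) {b : α}
    (hb : Relation.ReflTransGen r v b) : b ∈ outBall r v W.card := by
  have key : ∀ j, (∀ b, Relation.ReflTransGen r v b → b ∈ outBall r v j) ∨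
      j + 1 ≤ (outBall r v j).card := by
    intro j
    induction j with
    | zero => right; simp [outBall]
    | succ j ih =>
      by_cases hall : ∀ b, Relation.ReflTransGen r v b → b ∈ outBall r v j
      · exact Or.inl fun b hb => outBall_mono r v (Nat.le_succ j) (hall b hb)
      · right
        have hne : outBall r v j ≠ outBall r v (j + 1) := by
          intro heq
          refine hall fun b hb => ?_
          induction hb with
          | refl => exact self_mem_outBall r v j
          | tail _ hab ih' => exact heq ▸ mem_outBall_succ.2 (Or.inr ⟨_, ih', hab⟩)
        have hlt := Finset.card_lt_card
          ((outBall_mono r v (Nat.le_succ j)).lt_of_ne hne)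
        have := ih.resolve_left hall
        rw [Nat.succ_eq_add_one] at hlt
        omega
  have hsub : ∀ j, outBall r v j ⊆ W := by
    intro j
    induction j with
    | zero => simpa [outBall] using hv
    | succ j ih =>
      intro b hb
      rcases mem_outBall_succ.1 hb with hb | ⟨a, _, hab⟩
      · exact ih hb
      · exact hW a b hab
  rcases key W.card with h | h
  · exact h b hb
  · have := Finset.card_le_card (hsub W.card)
    omega

/-! ### A vertex whose reach is hit often -/

/-- There is an arc `a → b` (square `a`, circle `b`) among the rounds with index in `I` and less
than `s`. -/
def ArcIn {V : Type*} {t : ℕ} (h : Fin t → V × V) (I : Set (Fin t)) (s : ℕ) (a b : V) : Prop :=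
  ∃ i ∈ I, i.val < s ∧ h i = (a, b)

open Classical in
/-- The combinatorial heart. In a digraph whose arcs appear one after the other, every nonempty set
`P` closed under predecessors contains vertices `v` and `w` such that at least `deg w` arcs start,
at the moment they appear, at a vertex then reachable from `v`. When an arc leaving `u` is added,
the claim before it is applied to the ancestors of `u`: all of them reach `u`, so the count of each
of them increases, while degrees increase by at most one. -/
lemma exists_degree_le_reach {V : Type*} {t : ℕ} (h : Fin t → V × V) (I : Finset (Fin t)) (s : ℕ) :
    ∀ P : Set V, P.Nonempty → (∀ i ∈ I, i.val < s → (h i).2 ∈ P → (h i).1 ∈ P) →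
      ∃ v ∈ P, ∃ w ∈ P,
        (I.filter fun i : Fin t => i.val < s ∧ (w = (h i).1 ∨ w = (h i).2)).card ≤
        (I.filter fun i : Fin t => i.val < s ∧
          Relation.ReflTransGen (ArcIn h I i) v (h i).1).card := by
  induction s with
  | zero => rintro P ⟨v, hv⟩ -; exact ⟨v, hv, v, hv, by simp⟩
  | succ s ih =>
    intro P hP hclosed
    by_cases hi : ∃ i ∈ I, i.val = s ∧ (h i).1 ∈ P
    · obtain ⟨i, hiI, his, hiP⟩ := hi
      have hanc : {a | Relation.ReflTransGen (ArcIn h I s) a (h i).1} ⊆ P := by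
        intro a ha
        induction ha using Relation.ReflTransGen.head_induction_on with
        | refl => exact hiP
        | head hab _ ihb =>
          obtain ⟨j, hj, hjs, hjab⟩ := hab
          have := hclosed j hj (by omega)
          rw [hjab] at this
          exact this ihb
      obtain ⟨v, hv, w, hw, hle⟩ := ih {a | Relation.ReflTransGen (ArcIn h I s) a (h i).1}
        ⟨_, Relation.ReflTransGen.refl⟩ (by
          intro j hj hjs hj2
          exact Relation.ReflTransGen.head ⟨j, hj, hjs, rfl⟩ hj2)
      refine ⟨v, hanc hv, w, hanc hw, ?_⟩
      calc _ ≤ (insert i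
            (I.filter fun i : Fin t => i.val < s ∧ (w = (h i).1 ∨ w = (h i).2))).card := by
            refine Finset.card_le_card fun j hj => ?_
            simp only [Finset.mem_filter, Finset.mem_insert] at hj ⊢
            by_cases hjs : j.val = s
            · exact Or.inl (Fin.ext (hjs.trans his.symm))
            · exact Or.inr ⟨hj.1, by omega, hj.2.2⟩
        _ ≤ _ := (Finset.card_insert_le _ _).trans (Nat.add_le_add_right hle 1)
        _ = (insert i (I.filter fun i : Fin t => i.val < s ∧
              Relation.ReflTransGen (ArcIn h I i) v (h i).1)).card := by
            rw [Finset.card_insert_of_notMem]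
            simp [his]
        _ ≤ _ := by
            refine Finset.card_le_card fun j hj => ?_
            simp only [Finset.mem_filter, Finset.mem_insert] at hj ⊢
            rcases hj with rfl | hj
            · exact ⟨hiI, by omega, by rw [his]; exact hv⟩
            · exact ⟨hj.1, by omega, hj.2.2⟩
    · obtain ⟨v, hv, w, hw, hle⟩ := ih P hP fun i hiI his => hclosed i hiI (by omega)
      refine ⟨v, hv, w, hw, (Finset.card_le_card fun j hj => ?_).trans
        (hle.trans (Finset.card_le_card fun j hj => ?_))⟩
      · simp only [Finset.mem_filter] at hj ⊢
        refine ⟨hj.1, lt_of_le_of_ne (by omega) fun hjs => hi ⟨j, hj.1, hjs, ?_⟩, hj.2.2⟩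
        rcases hj.2.2 with rfl | rfl
        · exact hw
        · exact hclosed j hj.1 hj.2.1 hw
      · simp only [Finset.mem_filter] at hj ⊢
        exact ⟨hj.1, by omega, hj.2.2⟩

/-! ### Zones and hits -/

/-- The set of vertices watched on behalf of `v` after `s` rounds: the vertices reachable from `v`
in at most `k` steps along arcs of the first `s` rounds, directed from squares to circles. If there
are more than `B` of them, only `v` itself is watched, so that a zone never exceeds `max B 1`. -/
noncomputable def zone {n t : ℕ} (h : History n t) (B k s : ℕ) (v : Fin n) : Finset (Fin n) :=
  if (outBall (ArcIn h Set.univ s) v k).card ≤ B then outBall (ArcIn h Set.univ s) v k else {v}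

/-- The number of rounds in which the square lands in the current zone of `v`. -/
noncomputable def hits {n t : ℕ} (h : History n t) (B k : ℕ) (v : Fin n) : ℕ :=
  (Finset.univ.filter fun i : Fin t => (h i).1 ∈ zone h B k i v).card

lemma self_mem_zone {n t : ℕ} (h : History n t) (B k s : ℕ) (v : Fin n) :
    v ∈ zone h B k s v := by
  unfold zone
  split_ifs
  · exact self_mem_outBall _ _ _
  · simp

lemma card_zone_le {n t : ℕ} (h : History n t) {B : ℕ} (hB : 1 ≤ B) (k s : ℕ) (v : Fin n) :
    (zone h B k s v).card ≤ B := by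
  unfold zone
  split_ifs with hc
  · exact hc
  · simpa using hB

lemma arcIn_snoc {n t : ℕ} (h : History n t) (x : Fin n × Fin n) {s : ℕ} (hs : s ≤ t) :
    ArcIn (Fin.snoc (α := fun _ => Fin n × Fin n) h x : History n (t + 1)) Set.univ s =
      ArcIn h Set.univ s := by
  funext a b
  refine propext ⟨?_, ?_⟩
  · rintro ⟨i, -, his, hi⟩
    refine ⟨⟨i, by omega⟩, trivial, his, ?_⟩
    rw [← hi]
    exact (Fin.snoc_castSucc (α := fun _ => Fin n × Fin n) x h ⟨i, by omega⟩).symm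
  · rintro ⟨i, -, his, hi⟩
    exact ⟨i.castSucc, trivial, his, by
      rw [← hi]; exact Fin.snoc_castSucc (α := fun _ => Fin n × Fin n) x h i⟩

lemma zone_snoc {n t : ℕ} (h : History n t) (x : Fin n × Fin n) (B k : ℕ) {s : ℕ} (hs : s ≤ t)
    (v : Fin n) :
    zone (Fin.snoc (α := fun _ => Fin n × Fin n) h x : History n (t + 1)) B k s v =
      zone h B k s v := by
  unfold zone
  rw [arcIn_snoc h x hs]

lemma hits_snoc {n t : ℕ} (h : History n t) (x : Fin n × Fin n) (B k : ℕ) (v : Fin n) :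
    hits (Fin.snoc (α := fun _ => Fin n × Fin n) h x : History n (t + 1)) B k v =
      hits h B k v + if x.1 ∈ zone h B k t v then 1 else 0 := by
  unfold hits
  rw [Finset.card_filter, Finset.card_filter, Fin.sum_univ_castSucc]
  simp only [Fin.snoc_castSucc, Fin.snoc_last, Fin.val_castSucc, Fin.val_last]
  rw [zone_snoc h x B k le_rfl]
  congr 1
  exact Finset.sum_congr rfl fun i _ => by rw [zone_snoc h x B k i.2.le]

/-- If no vertex has `d` hits, then no vertex carries `d` squares, so no out-ball of radius `k` has
more than `d ^ k` elements and the truncation in `zone` never takes effect. -/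
lemma zone_eq_outBall {n t : ℕ} (h : History n t) {d : ℕ} (k : ℕ)
    (hh : ∀ v, hits h (d ^ k) k v < d) (s : ℕ) (v : Fin n) :
    zone h (d ^ k) k s v = outBall (ArcIn h Set.univ s) v k := by
  classical
  refine if_pos ?_
  have hd : 0 < d := (Nat.zero_le _).trans_lt (hh v)
  have hout : ∀ a, (Finset.univ.filter (ArcIn h Set.univ s a)).card ≤ d - 1 := by
    intro a
    calc _ ≤ ((Finset.univ.filter fun i : Fin t =>
            (h i).1 ∈ zone h (d ^ k) k i a).image fun i => (h i).2).card := by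
          refine Finset.card_le_card fun b hb => ?_
          obtain ⟨i, -, -, hi⟩ := (Finset.mem_filter.1 hb).2
          refine Finset.mem_image.2 ⟨i, Finset.mem_filter.2 ⟨Finset.mem_univ _, ?_⟩, by rw [hi]⟩
          rw [hi]
          exact self_mem_zone _ _ _ _ _
      _ ≤ hits h (d ^ k) k a := Finset.card_image_le
      _ ≤ d - 1 := Nat.le_sub_one_of_lt (hh a)
  simpa [Nat.sub_add_cancel hd] using card_outBall_le hout v k

/-- A subgraph of minimum degree at least `d` on at most `k` vertices forces a vertex with at least
`d` hits. -/
lemma exists_le_hits {n t : ℕ} (h : History n t) {d k : ℕ} (W : Finset (Fin n)) (hW : W.Nonempty)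
    (hk : W.card ≤ k) (I : Finset (Fin t)) (hI : ∀ i ∈ I, (h i).1 ∈ W ∧ (h i).2 ∈ W)
    (hdeg : ∀ w ∈ W, d ≤ (I.filter fun i => w = (h i).1 ∨ w = (h i).2).card) :
    ∃ v, d ≤ hits h (d ^ k) k v := by
  classical
  by_contra! hh
  obtain ⟨v, hv, w, hw, hle⟩ := exists_degree_le_reach h I t (W : Set (Fin n)) hW
    fun i hi _ _ => (hI i hi).1
  refine (hh v).not_ge ((hdeg w hw).trans ?_)
  have hlt : ∀ i : Fin t, i.val < t := fun i => i.2
  simp only [hlt, true_and] at hle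
  refine hle.trans (Finset.card_le_card fun i hi => ?_)
  rw [Finset.mem_filter] at hi ⊢
  refine ⟨Finset.mem_univ _, ?_⟩
  rw [zone_eq_outBall h k hh]
  refine outBall_subset_of_imp (fun a b ⟨j, _, hj⟩ => ⟨j, trivial, hj⟩) v k
    (outBall_mono _ v hk (mem_outBall_of_reflTransGen ?_ hv hi.2))
  rintro a b ⟨j, hj, -, hab⟩
  have := (hI j hj).2
  rwa [hab] at this

/-! ### Copies of graphs of large minimum degree -/

lemma exists_subgraph_of_degeneracy_eq {α β : Type*} {G : Graph α β} {d : ℕ} (hd : 1 ≤ d)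
    (hG : degeneracy G = d) :
    ∃ G' ≤ G, G'.vertexSet.Nonempty ∧ ∀ v ∈ G'.vertexSet, d ≤ degree G' v := by
  have hnot : ¬ IsDegenerate G (d - 1) :=
    Nat.notMem_of_lt_sInf (s := {d : ℕ | IsDegenerate G d})
      (show d - 1 < degeneracy G by omega)
  unfold IsDegenerate at hnot
  push Not at hnot
  obtain ⟨G', hle, hne, hG'⟩ := hnot
  exact ⟨G', hle, hne, fun v hv => by have := hG' v hv; omega⟩

lemma exists_le_hits_of_containsCopy {α β : Type*} {G : Graph α β} (hV : G.vertexSet.Finite)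
    (hE : G.edgeSet.Finite) {d : ℕ} (hd : 1 ≤ d) (hG : degeneracy G = d) {n t : ℕ}
    (h : History n t) (hc : ContainsCopy G (builtGraph h)) :
    ∃ v, d ≤ hits h (d ^ G.vertexSet.ncard) G.vertexSet.ncard v := by
  classical
  obtain ⟨G', hle, ⟨v₀, hv₀⟩, hdeg⟩ := exists_subgraph_of_degeneracy_eq hd hG
  obtain ⟨φ, ψ, hφψ⟩ := hc
  have hVle : ∀ {x}, x ∈ G'.vertexSet → x ∈ G.vertexSet := fun hx => hle.vertexSet_mono hx
  have hEle : ∀ {e}, e ∈ G'.edgeSet → e ∈ G.edgeSet := fun he => hle.edgeSet_mono he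
  have : Fintype G.vertexSet := hV.fintype
  have : Fintype G.edgeSet := hE.fintype
  -- the images of the vertices and edges of the subgraph
  let W : Finset (Fin n) :=
    (Finset.univ.filter fun x : G.vertexSet => x.1 ∈ G'.vertexSet).image fun x => (φ x).1
  let I : Finset (Fin t) :=
    (Finset.univ.filter fun e : G.edgeSet => e.1 ∈ G'.edgeSet).image fun e => (ψ e).1
  have hlink : ∀ {e x y} (hl : G'.IsLink e x y),
      s((h (ψ ⟨e, hEle hl.edge_mem⟩).1).1, (h (ψ ⟨e, hEle hl.edge_mem⟩).1).2) =
        s((φ ⟨x, hVle hl.left_mem⟩).1, (φ ⟨y, hVle hl.right_mem⟩).1) :=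
    fun hl => hφψ ⟨_, hEle hl.edge_mem⟩ ⟨_, hVle hl.left_mem⟩ ⟨_, hVle hl.right_mem⟩
      (hle.isLink_mono hl)
  have hWmem : ∀ {x} (hx : x ∈ G'.vertexSet), (φ ⟨x, hVle hx⟩).1 ∈ W := fun {x} hx =>
    Finset.mem_image.2 ⟨⟨x, hVle hx⟩, by simpa using hx, rfl⟩
  refine exists_le_hits h W ⟨_, hWmem hv₀⟩ ?_ I ?_ ?_
  · refine Finset.card_image_le.trans ((Finset.card_filter_le _ _).trans ?_)
    rw [Finset.card_univ, Set.ncard_eq_toFinset_card', Set.toFinset_card]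
  · intro i hi
    obtain ⟨⟨e, he⟩, he', rfl⟩ := Finset.mem_image.1 hi
    replace he' : e ∈ G'.edgeSet := by simpa using he'
    obtain ⟨x, y, hl⟩ := G'.exists_isLink_of_mem_edgeSet he'
    rcases Sym2.eq_iff.1 (hlink hl) with ⟨h1, h2⟩ | ⟨h1, h2⟩
    · exact ⟨h1 ▸ hWmem hl.left_mem, h2 ▸ hWmem hl.right_mem⟩
    · exact ⟨h1 ▸ hWmem hl.right_mem, h2 ▸ hWmem hl.left_mem⟩
  · intro w hw
    obtain ⟨⟨x, hx⟩, hx', rfl⟩ := Finset.mem_image.1 hw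
    replace hx' : x ∈ G'.vertexSet := by simpa using hx'
    refine (hdeg x hx').trans ?_
    have hinc : ∀ e ∈ G'.incidenceSet x, e ∈ G.edgeSet := fun e he => hEle he.edge_mem
    have : Fintype (G'.incidenceSet x) := (hE.subset hinc).fintype
    unfold degree
    rw [Set.ncard_eq_toFinset_card', Set.toFinset_card, ← Finset.card_univ]
    refine Finset.card_le_card_of_injOn (fun e => (ψ ⟨e.1, hinc _ e.2⟩).1) ?_ ?_
    · intro e _
      obtain ⟨y, hl⟩ := e.2
      refine Finset.mem_coe.2 (Finset.mem_filter.2 ⟨Finset.mem_image.2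
        ⟨⟨e.1, hinc _ e.2⟩, by simpa using hl.edge_mem, rfl⟩, ?_⟩)
      rcases Sym2.eq_iff.1 (hlink hl) with ⟨h1, -⟩ | ⟨-, h2⟩
      · exact Or.inl h1.symm
      · exact Or.inr h2.symm
    · intro e _ e' _ hee'
      have := ψ.injective (Subtype.ext hee')
      exact Subtype.ext (Subtype.mk.inj this)

/-! ### The exponential moment of the hits -/

lemma tsum_bind_mul {α β : Type*} (p : PMF α) (f : α → PMF β) (g : β → ℝ≥0∞) :
    ∑' b, (p.bind f) b * g b = ∑' a, p a * ∑' b, f a b * g b := by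
  simp_rw [PMF.bind_apply, ← ENNReal.tsum_mul_right, ← ENNReal.tsum_mul_left]
  rw [ENNReal.tsum_comm]
  simp_rw [mul_assoc]

lemma tsum_map_mul {α β : Type*} (p : PMF α) (f : α → β) (g : β → ℝ≥0∞) :
    ∑' b, (p.map f) b * g b = ∑' a, p a * g (f a) := by
  rw [← PMF.bind_pure_comp, tsum_bind_mul]
  refine tsum_congr fun a => ?_
  rw [tsum_eq_single (f a)]
  · simp
  · intro b hb
    simp [PMF.pure_apply_of_ne _ _ hb]

/-- The mean, over a uniform square, of the factor by which one round multiplies `z ^ hits`. -/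
lemma inv_mul_sum_ite_le {n : ℕ} [NeZero n] (z : ℝ≥0∞) {B : ℕ} {A : Finset (Fin n)}
    (hA : A.card ≤ B) :
    (n : ℝ≥0∞)⁻¹ * ∑ u : Fin n, (if u ∈ A then z else 1) ≤ 1 + B * z / n := by
  have hn : (n : ℝ≥0∞) ≠ 0 := by exact_mod_cast NeZero.ne n
  calc (n : ℝ≥0∞)⁻¹ * ∑ u : Fin n, (if u ∈ A then z else 1)
      ≤ (n : ℝ≥0∞)⁻¹ * ∑ u : Fin n, (1 + if u ∈ A then z else 0) := by
        gcongr with u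
        split_ifs <;> simp
    _ = (n : ℝ≥0∞)⁻¹ * (n + A.card * z) := by
        rw [Finset.sum_add_distrib, Finset.sum_ite_mem]
        simp
    _ ≤ (n : ℝ≥0∞)⁻¹ * (n + B * z) := by gcongr
    _ = 1 + B * z / n := by
        rw [mul_add, ENNReal.inv_mul_cancel hn (ENNReal.natCast_ne_top n), mul_comm _ (B * z),
          div_eq_mul_inv]

lemma tsum_historyLaw_mul_le {n : ℕ} [NeZero n] (S : Strategy n) (z : ℝ≥0∞) {B : ℕ} (hB : 1 ≤ B)
    (k t : ℕ) :
    ∑' h, historyLaw S t h * ∑ v, z ^ hits h B k v ≤ n * (1 + B * z / n) ^ t := by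
  induction t with
  | zero =>
    have h0 : ∀ h : History n 0, ∑ v, z ^ hits h B k v = n := by
      intro h
      simp [hits]
    simp_rw [h0]
    rw [ENNReal.tsum_mul_right, PMF.tsum_coe]
    simp
  | succ t ih =>
    have hstep : ∀ h : History n t,
        ∑' u, PMF.uniformOfFintype (Fin n) u * ∑' w, S t h u w *
          ∑ v, z ^ hits (Fin.snoc (α := fun _ => Fin n × Fin n) h (u, w) : History n (t + 1)) B k v
        ≤ (∑ v, z ^ hits h B k v) * (1 + B * z / n) := by
      intro h
      -- whether the zone of a vertex is hit depends on the square only, not on the player's answer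
      have hsnoc : ∀ u w v,
          z ^ hits (Fin.snoc (α := fun _ => Fin n × Fin n) h (u, w) : History n (t + 1)) B k v =
            z ^ hits h B k v * if u ∈ zone h B k t v then z else 1 := by
        intro u w v
        rw [hits_snoc]
        split_ifs <;> simp [pow_succ]
      simp_rw [hsnoc, ENNReal.tsum_mul_right, PMF.tsum_coe, one_mul, tsum_fintype,
        PMF.uniformOfFintype_apply, Fintype.card_fin, Finset.mul_sum]
      rw [Finset.sum_comm, Finset.sum_mul]
      refine Finset.sum_le_sum fun v _ => ?_
      simp_rw [mul_left_comm _ (z ^ hits h B k v)]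
      rw [← Finset.mul_sum, ← Finset.mul_sum]
      gcongr
      exact inv_mul_sum_ite_le z (card_zone_le h hB k t v)
    calc _ = ∑' h, historyLaw S t h *
            ∑' u, PMF.uniformOfFintype (Fin n) u * ∑' w, S t h u w * ∑ v,
              z ^ hits (Fin.snoc (α := fun _ => Fin n × Fin n) h (u, w) : History n (t + 1))
                B k v := by
          simp_rw [historyLaw, tsum_bind_mul, tsum_map_mul]
      _ ≤ ∑' h, historyLaw S t h * ((∑ v, z ^ hits h B k v) * (1 + B * z / n)) :=
          ENNReal.tsum_le_tsum fun h => mul_le_mul_right (hstep h) _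
      _ ≤ n * (1 + B * z / n) ^ t * (1 + B * z / n) := by
          simp_rw [← mul_assoc]
          rw [ENNReal.tsum_mul_right]
          gcongr
      _ = _ := by rw [pow_succ, mul_assoc]

/-- Markov's inequality for the exponential moment. -/
lemma toOuterMeasure_exists_le_hits_mul_le {n : ℕ} [NeZero n] (S : Strategy n) {z : ℝ≥0∞}
    (hz : 1 ≤ z) {B : ℕ} (hB : 1 ≤ B) (d k t : ℕ) :
    (historyLaw S t).toOuterMeasure {h | ∃ v, d ≤ hits h B k v} * z ^ d ≤
      n * (1 + B * z / n) ^ t := by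
  refine le_trans ?_ (tsum_historyLaw_mul_le S z hB k t)
  rw [PMF.toOuterMeasure_apply, ← ENNReal.tsum_mul_right]
  refine ENNReal.tsum_le_tsum fun h => ?_
  by_cases hh : ∃ v, d ≤ hits h B k v
  · rw [Set.indicator_of_mem (show h ∈ {h | ∃ v, d ≤ hits h B k v} from hh)]
    obtain ⟨v, hv⟩ := hh
    gcongr
    exact (pow_le_pow_right₀ hz hv).trans
      (Finset.single_le_sum (f := fun v => z ^ hits h B k v) (fun _ _ => zero_le)
        (Finset.mem_univ v))
  · rw [Set.indicator_of_notMem (show h ∉ {h | ∃ v, d ≤ hits h B k v} from hh)]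
    simp

/-! ### The probability of a copy -/

lemma copyProb_mul_pow_le {α β : Type*} {G : Graph α β} (hV : G.vertexSet.Finite)
    (hE : G.edgeSet.Finite) {d : ℕ} (hd : 1 ≤ d) (hG : degeneracy G = d) {n : ℕ} [NeZero n]
    (S : Strategy n) (t : ℕ) {z : ℝ≥0∞} (hz : 1 ≤ z) :
    copyProb G S t * z ^ d ≤ n * (1 + (d ^ G.vertexSet.ncard : ℕ) * z / n) ^ t := by
  refine le_trans ?_ (toOuterMeasure_exists_le_hits_mul_le S hz (Nat.one_le_pow _ _ hd) d
    G.vertexSet.ncard t)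
  gcongr
  exact (historyLaw S t).toOuterMeasure.mono fun h hc =>
    exists_le_hits_of_containsCopy hV hE hd hG h hc

/-- The choice `z = n ^ (1 / d) * ω` makes `z * t / n` bounded and `z ^ d / n = ω ^ d` large. -/
lemma copyProb_le {α β : Type*} {G : Graph α β} (hV : G.vertexSet.Finite)
    (hE : G.edgeSet.Finite) {d : ℕ} (hd : 1 ≤ d) (hG : degeneracy G = d) {n : ℕ} [NeZero n]
    (S : Strategy n) (t : ℕ) {ω : ℝ} (hω : 1 ≤ ω)
    (ht : (t : ℝ) ≤ (n : ℝ) ^ (((d : ℝ) - 1) / (d : ℝ)) / ω) :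
    copyProb G S t ≤ ENNReal.ofReal (Real.exp (d ^ G.vertexSet.ncard : ℕ) / ω ^ d) := by
  set B : ℕ := d ^ G.vertexSet.ncard with hB
  have hn : 1 ≤ (n : ℝ) := by exact_mod_cast NeZero.one_le
  have hn0 : (0 : ℝ) < n := by linarith
  have hω0 : 0 < ω := by linarith
  have hd0 : (d : ℝ) ≠ 0 := by positivity
  set x : ℝ := (n : ℝ) ^ (1 / (d : ℝ)) * ω with hx
  have hx1 : 1 ≤ x := one_le_mul_of_one_le_of_one_le (Real.one_le_rpow hn (by positivity)) hω
  have hxd : x ^ d = n * ω ^ d := by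
    rw [hx, mul_pow, ← Real.rpow_natCast, ← Real.rpow_mul hn0.le, one_div_mul_cancel hd0,
      Real.rpow_one]
  have htx : t * x ≤ n := by
    calc t * x ≤ (n : ℝ) ^ (((d : ℝ) - 1) / (d : ℝ)) / ω * x := by gcongr
      _ = (n : ℝ) ^ (((d : ℝ) - 1) / (d : ℝ)) * (n : ℝ) ^ (1 / (d : ℝ)) := by
          rw [hx]; field_simp
      _ = n := by
          rw [← Real.rpow_add hn0, ← add_div, sub_add_cancel, div_self hd0, Real.rpow_one]
  have hpow : (1 + B * x / n) ^ t ≤ Real.exp B := by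
    calc (1 + B * x / n) ^ t ≤ Real.exp (B * x / n) ^ t := by
          gcongr
          rw [add_comm]
          exact Real.add_one_le_exp _
      _ = Real.exp (B * (t * x / n)) := by rw [← Real.exp_nat_mul]; ring_nf
      _ ≤ Real.exp B := by
          gcongr
          exact mul_le_of_le_one_right (by positivity) ((div_le_one hn0).2 htx)
  have key := copyProb_mul_pow_le hV hE hd hG S t (z := ENNReal.ofReal x)
    (by simpa using ENNReal.ofReal_le_ofReal hx1)
  have hrhs : (n : ℝ≥0∞) * (1 + (B : ℕ) * ENNReal.ofReal x / n) ^ t =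
      ENNReal.ofReal (n * (1 + B * x / n) ^ t) := by
    rw [ENNReal.ofReal_mul hn0.le, ENNReal.ofReal_pow (by positivity),
      ENNReal.ofReal_add zero_le_one (by positivity), ENNReal.ofReal_div_of_pos hn0,
      ENNReal.ofReal_mul (Nat.cast_nonneg B), ENNReal.ofReal_natCast, ENNReal.ofReal_natCast,
      ENNReal.ofReal_one]
  rw [← hB, hrhs, ← ENNReal.ofReal_pow (by positivity), hxd] at key
  have hpos : 0 < n * ω ^ d := by positivity
  rw [← ENNReal.le_div_iff_mul_le (Or.inl (ENNReal.ofReal_pos.2 hpos).ne') (Or.inl ENNReal.ofReal_ne_top),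
    ← ENNReal.ofReal_div_of_pos hpos] at key
  refine key.trans (ENNReal.ofReal_le_ofReal ?_)
  rw [mul_div_mul_left _ _ hn0.ne']
  gcongr

end SemiRandom

theorem mainTheorem1 {α β : Type*} (G : Graph α β)
    (hV : G.vertexSet.Finite) (hE : G.edgeSet.Finite)
    (d : ℕ) (hd : 2 ≤ d) (hG : SemiRandom.degeneracy G = d)
    (S : (n : ℕ+) → SemiRandom.Strategy (n : ℕ))
    (ω : ℕ+ → ℝ) (hω : Tendsto ω atTop atTop)
    (t : ℕ+ → ℕ)
    (ht : ∀ᶠ n : ℕ+ in atTop, (t n : ℝ) ≤ ((n : ℕ) : ℝ) ^ (((d : ℝ) - 1) / (d : ℝ)) / ω n) :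
    Tendsto (fun n : ℕ+ => SemiRandom.copyProb G (S n) (t n)) atTop (𝓝 0) := by
  have hd1 : 1 ≤ d := by omega
  have hlim : Tendsto (fun n : ℕ+ => ENNReal.ofReal
      (Real.exp (d ^ G.vertexSet.ncard : ℕ) / ω n ^ d)) atTop (𝓝 0) := by
    rw [← ENNReal.ofReal_zero]
    exact ENNReal.tendsto_ofReal
      (((tendsto_pow_atTop (by omega)).comp hω).const_div_atTop _)
  refine tendsto_of_tendsto_of_tendsto_of_le_of_le' tendsto_const_nhds hlim
    (Eventually.of_forall fun _ => zero_le) ?_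
  filter_upwards [ht, hω.eventually_ge_atTop 1] with n htn hωn
  exact SemiRandom.copyProb_le hV hE hd1 hG (S n) (t n) hωn htn
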